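/- \textbf{Theorem (Weak coreset via Bernstein inequality).} Let $(P,w)$ be a normalized weighted set of $n$ points $p_1,\dots,p_n\in\mathbb{R}^d$, that is, $w\in(0,\infty)^n$, $\sum_{i=1}^n w_i=1$, $\sum_{i=1}^n w_ip_i=\mathbf{0}$ and $\sum_{i=1}^n w_i\|p_i\|^2=1$. Let $\varepsilon,\delta\in(0,1)$. Put \[ s_i=\frac{w_i\,\|(p_i\mid 1)\|^2}{\sum_{j=1}^n w_j\,\|(p_j\mid 1)\|^2}\quad(1\le i\le n),\qquad k=\left\lceil\frac{4\log((d+1)/\delta)}{\varepsilon}\right\rceil , \] where $(p\mid 1)\in\mathbb{R}^{d+1}$ is $p$ with an additional last coordinate $1$. Draw $k$ indices independently from $\{1,\dots,n\}$, each equal to $i$ with probability $s_i$, let $c_i$ be the number of times that $i$ was drawn, and let $u=(u_1,\dots,u_n)$ with \[ u_i=\frac{2c_i}{k\,\|(p_i\mid 1)\|^2}. \] Then $u\in[0,\infty)^n$ always has at most $\left\lceil\frac{4\log((d+1)/\delta)}{\varepsilon}\right\rceil$ non-zero entries, and $(P,u)$ is a weak mean $(\varepsilon,\delta)$-coreset for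 $(P,w)$: with probability at least $1-\delta$, for all $\bar p\in\arg\min_{x\in\mathbb{R}^d}\sum_{i=1}^n w_i\|p_i-x\|^2$ and $\bar s\in\arg\min_{x\in\mathbb{R}^d}\sum_{i=1}^n u_i\|p_i-x\|^2$, \[ \left|\sum_{i=1}^n w_i\|p_i-\bar p\|^2-\sum_{i=1}^n w_i\|p_i-\bar s\|^2\right|\le\varepsilon\sum_{i=1}^n w_i\|p_i-\bar p\|^2 . \] -/

import Mathlib

open MeasureTheory ProbabilityTheory

noncomputable section

namespace MeanCoreset

/-- The weighted sum of squared distances `∑ i, w i * ‖p i - x‖²`. -/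
def cost {n d : ℕ} (p : Fin n → EuclideanSpace ℝ (Fin d)) (w : Fin n → ℝ)
    (x : EuclideanSpace ℝ (Fin d)) : ℝ :=
  ∑ i, w i * ‖p i - x‖ ^ 2

/-- The set of global minimizers of the cost of `(P, w)` over the whole space. -/
def argminCost {n d : ℕ} (p : Fin n → EuclideanSpace ℝ (Fin d)) (w : Fin n → ℝ) :
    Set (EuclideanSpace ℝ (Fin d)) :=
  {x | ∀ y, cost p w x ≤ cost p w y}

/-- A normalized weighted set: positive weights that sum to one, weighted sum equal to the origin,
weighted sum of squared norms equal to one. -/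
structure IsNormalizedWeightedSet {n d : ℕ} (p : Fin n → EuclideanSpace ℝ (Fin d))
    (w : Fin n → ℝ) : Prop where
  weight_pos : ∀ i, 0 < w i
  sum_weight : ∑ i, w i = 1
  weighted_sum : ∑ i, w i • p i = 0
  weighted_sum_sq : ∑ i, w i * ‖p i‖ ^ 2 = 1

/-- The event inside the definition of a weak mean coreset: a minimizer `sbar` for the weights `u`
is, measured with the weights `w`, optimal up to a relative error `ε`. -/
def IsWeakCoreset {n d : ℕ} (p : Fin n → EuclideanSpace ℝ (Fin d)) (w u : Fin n → ℝ)
    (ε : ℝ) : Prop :=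
  ∀ pbar ∈ argminCost p w, ∀ sbar ∈ argminCost p u,
    |cost p w pbar - cost p w sbar| ≤ ε * cost p w pbar

/-- Weak mean `(ε, δ)`-coreset: the random weights `u` give a weak `ε`-coreset with probability
at least `1 - δ`. -/
def IsWeakCoresetWithProb {n d : ℕ} {Ω : Type*} [MeasurableSpace Ω] (μ : Measure Ω)
    (p : Fin n → EuclideanSpace ℝ (Fin d)) (w : Fin n → ℝ) (u : Ω → Fin n → ℝ)
    (ε δ : ℝ) : Prop :=
  1 - δ ≤ μ.real {ω | IsWeakCoreset p w (u ω) ε}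

/-- The vector `(x | 1)` in dimension `d + 1`. -/
def appendOne {d : ℕ} (x : EuclideanSpace ℝ (Fin d)) : EuclideanSpace ℝ (Fin (d + 1)) :=
  WithLp.toLp 2 (Fin.snoc (α := fun _ => ℝ) (fun j => x j) 1)

/-- The sampling distribution of the algorithm,
`s i = w i ‖(p i | 1)‖² / ∑ j, w j ‖(p j | 1)‖²`. -/
def samplingProb {n d : ℕ} (p : Fin n → EuclideanSpace ℝ (Fin d)) (w : Fin n → ℝ)
    (i : Fin n) : ℝ :=
  w i * ‖appendOne (p i)‖ ^ 2 / ∑ j, w j * ‖appendOne (p j)‖ ^ 2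

/-- The number of samples drawn by the algorithm, `4 log((d+1)/δ) / ε` rounded up. -/
def sampleSize (d : ℕ) (ε δ : ℝ) : ℕ :=
  ⌈4 * Real.log (((d : ℝ) + 1) / δ) / ε⌉₊

/-- The number of times the index `i` occurs in the sample `S`. -/
def sampleCount {n k : ℕ} (S : Fin k → Fin n) (i : Fin n) : ℕ :=
  (Finset.univ.filter (fun j => S j = i)).card

/-- The weights returned by the algorithm when the drawn sample of indices is `S`:
`u i = 2 c i / (k ‖(p i | 1)‖²)`, where `c i` counts the occurrences of `i` in `S`. -/
def sampleWeights {n d k : ℕ} (p : Fin n → EuclideanSpace ℝ (Fin d)) (S : Fin k → Fin n)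
    (i : Fin n) : ℝ :=
  2 * (sampleCount S i : ℝ) / ((k : ℝ) * ‖appendOne (p i)‖ ^ 2)

/-- `I 0, …, I (k-1)` are independent random indices, each equal to `i` with probability `s i`. -/
structure IsIIDSample {n k : ℕ} {Ω : Type*} [MeasurableSpace Ω] (μ : Measure Ω)
    (s : Fin n → ℝ) (I : Fin k → Ω → Fin n) : Prop where
  measurable : ∀ j, Measurable (I j)
  indep : iIndepFun I μ
  law : ∀ j i, μ.real {ω | I j ω = i} = s i

/-- `u` is the (random) output of a call to the Bernstein-based importance sampling algorithm with
input `(P, w)`, error parameter `ε` and failure probability `δ`: the weights of an i.i.d. sample of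
`sampleSize d ε δ` indices drawn from the distribution `samplingProb p w`. -/
def IsBernsteinCoresetOutput {n d : ℕ} {Ω : Type*} [MeasurableSpace Ω] (μ : Measure Ω)
    (p : Fin n → EuclideanSpace ℝ (Fin d)) (w : Fin n → ℝ) (ε δ : ℝ)
    (u : Ω → Fin n → ℝ) : Prop :=
  ∃ I : Fin (sampleSize d ε δ) → Ω → Fin n,
    IsIIDSample μ (samplingProb p w) I ∧
      ∀ ω, u ω = sampleWeights p (fun j => I j ω)

end MeanCoreset

end

/-!
Since `(P, w)` is normalized, the minimizer for `w` is the origin, with cost `1`, and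
`cost p w x = 1 + ‖x‖ ^ 2`. Hence the weights `u` are good as soon as the `u`-mean `x` of the points
satisfies `‖x‖ ^ 2 ≤ ε`.

Put `q i = (p i | 1)` and `e = (0 | 1)`. The sampling distribution is `s i = w i * ‖q i‖ ^ 2 / 2`, and
one draw of `i` contributes `(2 / ‖q i‖ ^ 2) • q i`, whose expectation is `e`. The centred
contribution `y i = (2 / ‖q i‖ ^ 2) • q i - e` is the inverse stereographic projection of `p i`, so it
is a *unit* vector (`norm_centeredSample`). The output weights therefore satisfy
`∑ i, u i • q i - e = k⁻¹ • (sum of k independent centred unit vectors)`, and the theorem follows from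
two facts.

* A dimension-free tail bound (`sum_prod_tail_le`): the norm of a sum of `k` independent centred
  unit vectors exceeds `k * t` with probability at most `2 * exp (-k * t ^ 2 / 2)`. Because
  `r ↦ cosh (√r)` is convex on `[0, ∞)`, the quantity `cosh (l * ‖x + y‖)` lies below its chord as a
  function of `⟪x, y⟫` in `[-‖x‖, ‖x‖]`. Taking expectations, adding one centred unit vector
  multiplies the expected `cosh (l * ‖x‖)` by at most `cosh l ≤ exp (l ^ 2 / 2)`. Markov's inequality
  finishes the argument.
* A deterministic estimate (`isWeakCoreset_of_norm_lt`): if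
  `‖∑ i, u i • q i - e‖ ^ 2 < ε / (1 + ε)`, then the `u`-mean has squared norm at most `ε`. With
  `U = ∑ i, u i` this is the inequality `ε / (1 + ε) - (U - 1) ^ 2 ≤ ε * U ^ 2`.

For `t ^ 2 = ε / (1 + ε)` and `ε < 1` the exponent is at least `k * ε / 4 ≥ log ((d + 1) / δ)`. The
failure probability is therefore at most `2 * δ / (d + 1)`, which is at most `δ` since normalization
forces `d ≥ 1`.
-/

namespace MeanCoreset

open scoped InnerProductSpace

/-! ### Hyperbolic cosine of the norm -/

/-- The power series of `cosh (√r)` in `r` has nonnegative coefficients, so convexity holds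
term by term. -/
lemma convexOn_cosh_sqrt : ConvexOn ℝ (Set.Ici 0) (fun r : ℝ => Real.cosh √r) := by
  have hs : ∀ r : ℝ, 0 ≤ r →
      HasSum (fun m : ℕ => r ^ m / ((2 * m).factorial : ℝ)) (Real.cosh √r) := by
    intro r hr
    have h := Real.hasSum_cosh √r
    simpa only [pow_mul, Real.sq_sqrt hr] using h
  refine ⟨convex_Ici 0, fun x hx y hy a b ha hb hab => ?_⟩
  simp only [Set.mem_Ici, smul_eq_mul] at *
  refine hasSum_le (fun m => ?_) (hs (a * x + b * y) (by positivity))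
    (((hs x hx).mul_left a).add ((hs y hy).mul_left b))
  have h := (convexOn_pow m).2 (Set.mem_Ici.2 hx) (Set.mem_Ici.2 hy) ha hb hab
  simp only [smul_eq_mul] at h
  rw [← mul_div_assoc, ← mul_div_assoc, ← add_div]
  gcongr

section UnitVectors

variable {E : Type*} [NormedAddCommGroup E] [InnerProductSpace ℝ E]

/-- For a unit vector `y`, the function `cosh (l * ‖x + y‖)` of `⟪x, y⟫` lies below its chord over
`[-‖x‖, ‖x‖]`. For `x = 0` the quotient is zero and the two sides agree. -/
lemma cosh_mul_norm_add_le (l : ℝ) (x y : E) (hy : ‖y‖ = 1) :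
    Real.cosh (l * ‖x + y‖) ≤ Real.cosh (l * ‖x‖) * Real.cosh l +
      ⟪x, y⟫_ℝ * (Real.sinh (l * ‖x‖) * Real.sinh l / ‖x‖) := by
  rcases eq_or_ne x 0 with rfl | hx
  · simp [hy]
  have hr : 0 < ‖x‖ := norm_pos_iff.2 hx
  set r := ‖x‖ with hr_def
  set c := ⟪x, y⟫_ℝ / r with hc_def
  have hcr : ⟪x, y⟫_ℝ = c * r := by rw [hc_def]; field_simp
  have hc : |c| ≤ 1 := by
    have h := abs_real_inner_le_norm x y
    rw [hcr, hy, abs_mul, abs_of_pos hr, mul_one] at h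
    exact le_of_mul_le_mul_right (by linarith) hr
  have ⟨hc1, hc2⟩ := abs_le.1 hc
  have hsq : ‖x + y‖ ^ 2 = r ^ 2 + 2 * (c * r) + 1 := by
    rw [norm_add_sq_real, hy, hcr]; ring
  have ha : 0 ≤ (1 + c) / 2 := by linarith
  have hb : 0 ≤ (1 - c) / 2 := by linarith
  have hconv := convexOn_cosh_sqrt.2 (Set.mem_Ici.2 (sq_nonneg (l * (r + 1))))
    (Set.mem_Ici.2 (sq_nonneg (l * (r - 1)))) ha hb (by ring)
  have harg : (1 + c) / 2 * (l * (r + 1)) ^ 2 + (1 - c) / 2 * (l * (r - 1)) ^ 2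
      = (l * ‖x + y‖) ^ 2 := by
    rw [mul_pow l ‖x + y‖, hsq]; ring
  simp only [smul_eq_mul, harg, Real.sqrt_sq_eq_abs, Real.cosh_abs] at hconv
  refine hconv.trans (le_of_eq ?_)
  rw [mul_add, mul_sub, mul_one, Real.cosh_add, Real.cosh_sub, hcr]
  field_simp
  ring

variable {ι : Type*} [Fintype ι]

/-- Each further independent centred unit vector costs a factor `cosh l` in the expectation of
`cosh (l * ‖·‖)`; the expectation over `k` draws is written as a sum over all samples. -/
lemma sum_prod_mul_cosh_le (s : ι → ℝ) (hs : ∀ i, 0 ≤ s i) (hs1 : ∑ i, s i = 1) (y : ι → E)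
    (hy : ∀ i, ‖y i‖ = 1) (hmean : ∑ i, s i • y i = 0) (l : ℝ) (k : ℕ) (x : E) :
    ∑ S : Fin k → ι, (∏ j, s (S j)) * Real.cosh (l * ‖x + ∑ j, y (S j)‖)
      ≤ Real.cosh (l * ‖x‖) * Real.cosh l ^ k := by
  induction k generalizing x with
  | zero => simp
  | succ k ih =>
    rw [← (Fin.consEquiv (fun _ => ι)).sum_comp, Fintype.sum_prod_type]
    simp only [Fin.consEquiv_apply, Fin.prod_univ_succ, Fin.sum_univ_succ, Fin.cons_zero,
      Fin.cons_succ, ← add_assoc, mul_assoc]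
    simp only [← Finset.mul_sum]
    have hstep : ∑ i, s i * Real.cosh (l * ‖x + y i‖)
        ≤ Real.cosh (l * ‖x‖) * Real.cosh l := by
      calc ∑ i, s i * Real.cosh (l * ‖x + y i‖)
          ≤ ∑ i, s i * (Real.cosh (l * ‖x‖) * Real.cosh l +
              ⟪x, y i⟫_ℝ * (Real.sinh (l * ‖x‖) * Real.sinh l / ‖x‖)) :=
            Finset.sum_le_sum fun i _ =>
              mul_le_mul_of_nonneg_left (cosh_mul_norm_add_le l x (y i) (hy i)) (hs i)
        _ = (∑ i, s i) * (Real.cosh (l * ‖x‖) * Real.cosh l) +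
              ⟪x, ∑ i, s i • y i⟫_ℝ * (Real.sinh (l * ‖x‖) * Real.sinh l / ‖x‖) := by
            simp only [mul_add, Finset.sum_add_distrib, ← Finset.sum_mul, inner_sum,
              real_inner_smul_right, ← mul_assoc]
        _ = Real.cosh (l * ‖x‖) * Real.cosh l := by simp [hs1, hmean]
    calc ∑ i, s i * ∑ S : Fin k → ι, (∏ j, s (S j)) * Real.cosh (l * ‖x + y i + ∑ j, y (S j)‖)
        ≤ ∑ i, s i * (Real.cosh (l * ‖x + y i‖) * Real.cosh l ^ k) :=
          Finset.sum_le_sum fun i _ => mul_le_mul_of_nonneg_left (ih (x + y i)) (hs i)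
      _ = (∑ i, s i * Real.cosh (l * ‖x + y i‖)) * Real.cosh l ^ k := by
          simp only [Finset.sum_mul, mul_assoc]
      _ ≤ Real.cosh (l * ‖x‖) * Real.cosh l * Real.cosh l ^ k :=
          mul_le_mul_of_nonneg_right hstep (pow_nonneg (Real.cosh_pos l).le k)
      _ = Real.cosh (l * ‖x‖) * Real.cosh l ^ (k + 1) := by ring

open Classical in
/-- Hoeffding's inequality for independent centred unit vectors in an inner product space, with the
probability of the tail event written as a sum over all samples. -/
lemma sum_prod_tail_le (s : ι → ℝ) (hs : ∀ i, 0 ≤ s i) (hs1 : ∑ i, s i = 1) (y : ι → E)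
    (hy : ∀ i, ‖y i‖ = 1) (hmean : ∑ i, s i • y i = 0) {t : ℝ} (ht : 0 ≤ t) (k : ℕ) :
    ∑ S : Fin k → ι with k * t ≤ ‖∑ j, y (S j)‖, ∏ j, s (S j)
      ≤ 2 * Real.exp (-(k * t ^ 2 / 2)) := by
  have hprod : ∀ S : Fin k → ι, 0 ≤ ∏ j, s (S j) := fun S => Finset.prod_nonneg fun j _ => hs _
  -- Markov's inequality for `cosh (l * ‖·‖)` with the optimal parameter `l = t`.
  have hmarkov : (∑ S : Fin k → ι with k * t ≤ ‖∑ j, y (S j)‖, ∏ j, s (S j)) *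
      (Real.exp (k * t ^ 2) / 2) ≤ Real.exp (k * t ^ 2 / 2) := by
    calc (∑ S : Fin k → ι with k * t ≤ ‖∑ j, y (S j)‖, ∏ j, s (S j)) *
          (Real.exp (k * t ^ 2) / 2)
        ≤ ∑ S : Fin k → ι with k * t ≤ ‖∑ j, y (S j)‖,
            (∏ j, s (S j)) * Real.cosh (t * ‖∑ j, y (S j)‖) := by
          rw [Finset.sum_mul]
          refine Finset.sum_le_sum fun S hS => mul_le_mul_of_nonneg_left ?_ (hprod S)
          have hS' := (Finset.mem_filter.1 hS).2
          have h1 : k * t ^ 2 ≤ t * ‖∑ j, y (S j)‖ := by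
            nlinarith [mul_le_mul_of_nonneg_left hS' ht]
          rw [Real.cosh_eq]
          have := Real.exp_le_exp.2 h1
          have := Real.exp_pos (-(t * ‖∑ j, y (S j)‖))
          linarith
      _ ≤ ∑ S : Fin k → ι, (∏ j, s (S j)) * Real.cosh (t * ‖∑ j, y (S j)‖) :=
          Finset.sum_le_sum_of_subset_of_nonneg (Finset.filter_subset _ _)
            fun S _ _ => mul_nonneg (hprod S) (Real.cosh_pos _).le
      _ ≤ Real.cosh t ^ k := by
          simpa using sum_prod_mul_cosh_le s hs hs1 y hy hmean t k 0
      _ ≤ Real.exp (t ^ 2 / 2) ^ k :=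
          pow_le_pow_left₀ (Real.cosh_pos t).le (Real.cosh_le_exp_half_sq t) k
      _ = Real.exp (k * t ^ 2 / 2) := by rw [← Real.exp_nat_mul]; congr 1; ring
  have hsplit : Real.exp (k * t ^ 2) = Real.exp (k * t ^ 2 / 2) * Real.exp (k * t ^ 2 / 2) := by
    rw [← Real.exp_add]; congr 1; ring
  have hpos := Real.exp_pos (k * t ^ 2 / 2)
  rw [Real.exp_neg, ← div_eq_mul_inv, le_div_iff₀ hpos]
  rw [hsplit] at hmarkov
  refine le_of_mul_le_mul_right ?_ hpos
  linarith

end UnitVectors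

/-! ### Law of the sample -/

lemma IsIIDSample.real_forall_eq {n k : ℕ} {Ω : Type*} [MeasurableSpace Ω] {μ : Measure Ω}
    {s : Fin n → ℝ} {I : Fin k → Ω → Fin n} (hI : IsIIDSample μ s I) (S : Fin k → Fin n) :
    μ.real {ω | (fun j => I j ω) = S} = ∏ j, s (S j) := by
  have hset : {ω | (fun j => I j ω) = S} = ⋂ j ∈ Finset.univ, I j ⁻¹' {S j} := by
    ext ω; simp [funext_iff]
  rw [hset, measureReal_def, hI.indep.measure_inter_preimage_eq_mul _
    (fun j _ => measurableSet_singleton (S j)), ENNReal.toReal_prod]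
  exact Finset.prod_congr rfl fun j _ => hI.law j (S j)

open Classical in
lemma IsIIDSample.real_setOf {n k : ℕ} {Ω : Type*} [MeasurableSpace Ω] {μ : Measure Ω}
    [IsFiniteMeasure μ] {s : Fin n → ℝ} {I : Fin k → Ω → Fin n} (hI : IsIIDSample μ s I)
    (Q : (Fin k → Fin n) → Prop) :
    μ.real {ω | Q (fun j => I j ω)} = ∑ S with Q S, ∏ j, s (S j) := by
  have hset : {ω | Q (fun j => I j ω)} =
      ⋃ S ∈ Finset.univ.filter Q, {ω | (fun j => I j ω) = S} := by
    ext ω; simp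
  rw [hset, measureReal_biUnion_finset]
  · exact Finset.sum_congr rfl fun S _ => hI.real_forall_eq S
  · intro S _ T _ hST
    exact Set.disjoint_left.2 fun ω h1 h2 => hST (h1.symm.trans h2)
  · intro S _
    exact (measurable_pi_lambda _ hI.measurable) (measurableSet_singleton S)

/-! ### Minimizers of the cost -/

section Cost

variable {n d : ℕ} (p : Fin n → EuclideanSpace ℝ (Fin d))

lemma cost_eq (w : Fin n → ℝ) (x : EuclideanSpace ℝ (Fin d)) :
    cost p w x =
      ∑ i, w i * ‖p i‖ ^ 2 - 2 * ⟪∑ i, w i • p i, x⟫_ℝ + (∑ i, w i) * ‖x‖ ^ 2 := by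
  simp only [cost, sum_inner, real_inner_smul_left, norm_sub_sq_real, mul_add, mul_sub,
    Finset.sum_add_distrib, Finset.sum_sub_distrib, Finset.sum_mul, Finset.mul_sum]
  congr 2
  exact Finset.sum_congr rfl fun i _ => by ring

lemma sum_smul_eq_of_mem_argminCost {u : Fin n → ℝ} (hu : 0 < ∑ i, u i)
    {x : EuclideanSpace ℝ (Fin d)} (hx : x ∈ argminCost p u) :
    (∑ i, u i) • x = ∑ i, u i • p i := by
  set U := ∑ i, u i with hU
  have h := hx (U⁻¹ • ∑ i, u i • p i)
  rw [cost_eq, cost_eq, ← hU] at h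
  set M := ∑ i, u i • p i with hM
  -- Completing the square: the excess cost of `x` is `‖U • x - M‖ ^ 2 / U`.
  have hsq : ‖U • x - M‖ ^ 2 = U ^ 2 * ‖x‖ ^ 2 - 2 * U * ⟪M, x⟫_ℝ + ‖M‖ ^ 2 := by
    rw [norm_sub_sq_real, real_inner_smul_left, norm_smul, mul_pow, Real.norm_eq_abs, sq_abs,
      real_inner_comm]
    ring
  have hM1 : ⟪M, U⁻¹ • M⟫_ℝ = U⁻¹ * ‖M‖ ^ 2 := by
    rw [real_inner_smul_right, real_inner_self_eq_norm_sq]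
  have hM2 : ‖U⁻¹ • M‖ ^ 2 = U⁻¹ ^ 2 * ‖M‖ ^ 2 := by
    rw [norm_smul, mul_pow, Real.norm_eq_abs, sq_abs]
  rw [hM1, hM2] at h
  have h2 := mul_le_mul_of_nonneg_left h hu.le
  have h3 : U * U⁻¹ = 1 := mul_inv_cancel₀ hu.ne'
  have h4 : U * (∑ i, u i * ‖p i‖ ^ 2 - 2 * (U⁻¹ * ‖M‖ ^ 2) + U * (U⁻¹ ^ 2 * ‖M‖ ^ 2))
      = U * ∑ i, u i * ‖p i‖ ^ 2 - ‖M‖ ^ 2 := by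
    field_simp; ring
  rw [h4] at h2
  have h5 : ‖U • x - M‖ ^ 2 ≤ 0 := by rw [hsq]; nlinarith
  have h6 : ‖U • x - M‖ = 0 := by
    exact pow_eq_zero_iff two_ne_zero |>.1 (le_antisymm h5 (sq_nonneg _))
  exact sub_eq_zero.1 (norm_eq_zero.1 h6)

variable {p} {w : Fin n → ℝ}

lemma IsNormalizedWeightedSet.cost_eq (hP : IsNormalizedWeightedSet p w)
    (x : EuclideanSpace ℝ (Fin d)) : cost p w x = 1 + ‖x‖ ^ 2 := by
  rw [MeanCoreset.cost_eq, hP.weighted_sum, hP.sum_weight, hP.weighted_sum_sq]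
  simp

lemma IsNormalizedWeightedSet.one_le_dim (hP : IsNormalizedWeightedSet p w) : 1 ≤ d := by
  rcases Nat.eq_zero_or_pos d with rfl | h
  · have h := hP.weighted_sum_sq
    have h0 : ∀ i, p i = 0 := fun i => Subsingleton.elim _ _
    simp [h0] at h
  · exact h

/-! ### Appending a coordinate -/

lemma inner_appendOne (x y : EuclideanSpace ℝ (Fin d)) :
    ⟪appendOne x, appendOne y⟫_ℝ = ⟪x, y⟫_ℝ + 1 := by
  simp [appendOne, PiLp.inner_apply, Fin.sum_univ_castSucc]

lemma norm_appendOne_sq (x : EuclideanSpace ℝ (Fin d)) : ‖appendOne x‖ ^ 2 = ‖x‖ ^ 2 + 1 := by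
  rw [← real_inner_self_eq_norm_sq, inner_appendOne, real_inner_self_eq_norm_sq]

lemma norm_appendOne_sq_pos (x : EuclideanSpace ℝ (Fin d)) : 0 < ‖appendOne x‖ ^ 2 := by
  rw [norm_appendOne_sq]; positivity

variable (p) in
lemma norm_sum_smul_appendOne_sub_sq (u : Fin n → ℝ) :
    ‖∑ i, u i • appendOne (p i) - appendOne 0‖ ^ 2 =
      ‖∑ i, u i • p i‖ ^ 2 + (∑ i, u i - 1) ^ 2 := by
  simp [EuclideanSpace.norm_sq_eq, Fin.sum_univ_castSucc, appendOne]

lemma IsNormalizedWeightedSet.sum_smul_appendOne (hP : IsNormalizedWeightedSet p w) :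
    ∑ i, w i • appendOne (p i) = appendOne 0 := by
  have h := norm_sum_smul_appendOne_sub_sq p w
  rw [hP.weighted_sum, hP.sum_weight] at h
  refine sub_eq_zero.1 (norm_eq_zero.1 (pow_eq_zero_iff two_ne_zero |>.1 ?_))
  rw [h]; simp

lemma IsNormalizedWeightedSet.samplingProb_eq (hP : IsNormalizedWeightedSet p w) (i : Fin n) :
    samplingProb p w i = w i * ‖appendOne (p i)‖ ^ 2 / 2 := by
  have h : ∑ j, w j * ‖appendOne (p j)‖ ^ 2 = 2 := by
    simp only [norm_appendOne_sq, mul_add, mul_one, Finset.sum_add_distrib, hP.weighted_sum_sq,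
      hP.sum_weight]
    norm_num
  rw [samplingProb, h]

lemma IsNormalizedWeightedSet.samplingProb_nonneg (hP : IsNormalizedWeightedSet p w)
    (i : Fin n) : 0 ≤ samplingProb p w i := by
  rw [hP.samplingProb_eq]
  have := hP.weight_pos i
  positivity

lemma IsNormalizedWeightedSet.sum_samplingProb (hP : IsNormalizedWeightedSet p w) :
    ∑ i, samplingProb p w i = 1 := by
  simp only [hP.samplingProb_eq, norm_appendOne_sq, ← Finset.sum_div, mul_add, mul_one,
    Finset.sum_add_distrib, hP.weighted_sum_sq, hP.sum_weight]
  norm_num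

/-! ### Centred samples -/

/-- The contribution `2 (x | 1) / ‖(x | 1)‖²` of drawing the point `x`, minus the common
expectation `(0 | 1)`; it is the inverse stereographic projection of `x` to the unit sphere. -/
noncomputable def centeredSample (x : EuclideanSpace ℝ (Fin d)) : EuclideanSpace ℝ (Fin (d + 1)) :=
  (2 / ‖appendOne x‖ ^ 2) • appendOne x - appendOne 0

lemma norm_centeredSample (x : EuclideanSpace ℝ (Fin d)) : ‖centeredSample x‖ = 1 := by
  have h : ‖centeredSample x‖ ^ 2 = 1 := by
    have h0 := (norm_appendOne_sq_pos x).ne'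
    rw [centeredSample, norm_sub_sq_real, real_inner_smul_left, inner_appendOne, norm_smul,
      mul_pow, Real.norm_eq_abs, sq_abs, norm_appendOne_sq (0 : EuclideanSpace ℝ (Fin d))]
    simp only [inner_zero_right, norm_zero]
    field_simp
    ring
  exact (pow_eq_one_iff_of_nonneg (norm_nonneg _) two_ne_zero).1 h

lemma IsNormalizedWeightedSet.sum_smul_centeredSample (hP : IsNormalizedWeightedSet p w) :
    ∑ i, samplingProb p w i • centeredSample (p i) = 0 := by
  simp only [centeredSample, smul_sub, Finset.sum_sub_distrib, ← Finset.sum_smul,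
    hP.sum_samplingProb, one_smul, smul_smul]
  rw [sub_eq_zero, ← hP.sum_smul_appendOne]
  refine Finset.sum_congr rfl fun i _ => ?_
  have h0 := (norm_appendOne_sq_pos (p i)).ne'
  rw [hP.samplingProb_eq, div_mul_div_comm, mul_comm 2, mul_div_mul_right _ _ two_ne_zero,
    mul_div_cancel_right₀ _ h0]

variable (p) in
lemma sum_sampleWeights_smul_appendOne_sub {k : ℕ} (hk : k ≠ 0) (S : Fin k → Fin n) :
    ∑ i, sampleWeights p S i • appendOne (p i) - appendOne 0 =
      (k : ℝ)⁻¹ • ∑ j, centeredSample (p (S j)) := by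
  have hk' : (k : ℝ) ≠ 0 := Nat.cast_ne_zero.2 hk
  have hcount : ∑ j, (2 / ‖appendOne (p (S j))‖ ^ 2) • appendOne (p (S j)) =
      ∑ i, (sampleCount S i : ℝ) • (2 / ‖appendOne (p i)‖ ^ 2) • appendOne (p i) := by
    rw [← Finset.sum_fiberwise' Finset.univ S
      (fun i => (2 / ‖appendOne (p i)‖ ^ 2) • appendOne (p i))]
    refine Finset.sum_congr rfl fun i _ => ?_
    rw [Finset.sum_const, sampleCount, Nat.cast_smul_eq_nsmul]
  simp only [centeredSample, Finset.sum_sub_distrib, hcount, smul_sub, Finset.sum_const,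
    Finset.card_univ, Fintype.card_fin]
  rw [← Nat.cast_smul_eq_nsmul ℝ, inv_smul_smul₀ hk', Finset.smul_sum]
  congr 1
  refine Finset.sum_congr rfl fun i _ => ?_
  rw [smul_smul, smul_smul, sampleWeights]
  congr 1
  have h0 := (norm_appendOne_sq_pos (p i)).ne'
  field_simp

/-! ### The coreset event -/

lemma isWeakCoreset_of_norm_lt (hP : IsNormalizedWeightedSet p w) {u : Fin n → ℝ} {ε : ℝ}
    (hε : 0 < ε) (h : ‖∑ i, u i • appendOne (p i) - appendOne 0‖ ^ 2 < ε / (1 + ε)) :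
    IsWeakCoreset p w u ε := by
  intro pbar hpbar sbar hsbar
  have hp0 : pbar = 0 := by
    have h := sum_smul_eq_of_mem_argminCost p (by rw [hP.sum_weight]; exact one_pos) hpbar
    rwa [hP.sum_weight, one_smul, hP.weighted_sum] at h
  rw [norm_sum_smul_appendOne_sub_sq] at h
  have hlt : ε / (1 + ε) < 1 := by rw [div_lt_one (by linarith)]; linarith
  have hU : 0 < ∑ i, u i := by
    have := sq_nonneg ‖∑ i, u i • p i‖
    nlinarith
  have hs := sum_smul_eq_of_mem_argminCost p hU hsbar
  rw [← hs, norm_smul, mul_pow, Real.norm_eq_abs, sq_abs] at h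
  set U := ∑ i, u i
  have hkey : ε / (1 + ε) - (U - 1) ^ 2 ≤ ε * U ^ 2 := by
    have h1 : ε * U ^ 2 - (ε / (1 + ε) - (U - 1) ^ 2) = ((1 + ε) * U - 1) ^ 2 / (1 + ε) := by
      field_simp; ring
    have h2 : 0 ≤ ((1 + ε) * U - 1) ^ 2 / (1 + ε) := by positivity
    linarith
  have hfin : ‖sbar‖ ^ 2 ≤ ε :=
    le_of_mul_le_mul_left (a := U ^ 2) (by linarith) (by positivity)
  rw [hP.cost_eq, hP.cost_eq, hp0]
  simpa using hfin

lemma sampleWeights_nonneg {k : ℕ} (S : Fin k → Fin n) (i : Fin n) :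
    0 ≤ sampleWeights p S i := by
  unfold sampleWeights; positivity

lemma hammingNorm_sampleWeights_le {k : ℕ} (S : Fin k → Fin n) :
    hammingNorm (sampleWeights p S) ≤ k := by
  classical
  calc hammingNorm (sampleWeights p S) ≤ (Finset.univ.image S).card := by
        refine Finset.card_le_card fun i hi => ?_
        by_contra hS
        refine (Finset.mem_filter.1 hi).2 ?_
        have h : sampleCount S i = 0 := by
          rw [sampleCount, Finset.card_eq_zero, Finset.filter_eq_empty_iff]
          exact fun j _ hj => hS (Finset.mem_image.2 ⟨j, Finset.mem_univ j, hj⟩)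
        simp [sampleWeights, h]
    _ ≤ k := Finset.card_image_le.trans (by simp)

end Cost

lemma two_mul_exp_neg_sampleSize_le {d : ℕ} (hd : 1 ≤ d) {ε δ : ℝ}
    (hε : ε ∈ Set.Ioo (0 : ℝ) 1) (hδ : 0 < δ) :
    2 * Real.exp (-(sampleSize d ε δ * (ε / (1 + ε)) / 2)) ≤ δ := by
  obtain ⟨hε0, hε1⟩ := hε
  have hd' : (1 : ℝ) ≤ d := by exact_mod_cast hd
  set k : ℝ := (sampleSize d ε δ : ℝ) with hk
  have hceil : 4 * Real.log (((d : ℝ) + 1) / δ) ≤ k * ε := by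
    rw [← div_le_iff₀ hε0]
    exact Nat.le_ceil _
  have hexp : Real.log (((d : ℝ) + 1) / δ) ≤ k * (ε / (1 + ε)) / 2 := by
    have h1 : ε / 2 ≤ ε / (1 + ε) := by gcongr; linarith
    have h2 : k * (ε / 2) ≤ k * (ε / (1 + ε)) :=
      mul_le_mul_of_nonneg_left h1 (Nat.cast_nonneg _)
    linarith
  calc 2 * Real.exp (-(k * (ε / (1 + ε)) / 2))
      ≤ 2 * Real.exp (-Real.log (((d : ℝ) + 1) / δ)) := by gcongr
    _ = 2 / ((d : ℝ) + 1) * δ := by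
        rw [Real.exp_neg, Real.exp_log (by positivity)]; field_simp
    _ ≤ δ := mul_le_of_le_one_left hδ.le ((div_le_one (by positivity)).2 (by linarith))

lemma sampleSize_ne_zero {d : ℕ} {ε δ : ℝ} (hε : 0 < ε) (hδ : δ ∈ Set.Ioo (0 : ℝ) 1) :
    sampleSize d ε δ ≠ 0 := by
  have hlog : 0 < Real.log (((d : ℝ) + 1) / δ) := by
    refine Real.log_pos ((one_lt_div hδ.1).2 ?_)
    have : (0 : ℝ) ≤ d := Nat.cast_nonneg d
    linarith [hδ.2]
  exact (Nat.ceil_pos.2 (by positivity)).ne'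

end MeanCoreset

open MeanCoreset in
theorem mainTheorem5 {n d : ℕ} (p : Fin n → EuclideanSpace ℝ (Fin d)) (w : Fin n → ℝ)
    (hP : MeanCoreset.IsNormalizedWeightedSet p w)
    (ε δ : ℝ) (hε : ε ∈ Set.Ioo (0 : ℝ) 1) (hδ : δ ∈ Set.Ioo (0 : ℝ) 1)
    {Ω : Type*} [MeasurableSpace Ω] (μ : MeasureTheory.Measure Ω)
    [MeasureTheory.IsProbabilityMeasure μ]
    (u : Ω → Fin n → ℝ) (hu : MeanCoreset.IsBernsteinCoresetOutput μ p w ε δ u) :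
    (∀ ω, (∀ i, 0 ≤ u ω i) ∧
      hammingNorm (u ω) ≤ ⌈4 * Real.log (((d : ℝ) + 1) / δ) / ε⌉₊) ∧
    MeanCoreset.IsWeakCoresetWithProb μ p w u ε δ := by
  classical
  obtain ⟨I, hI, hu⟩ := hu
  refine ⟨fun ω => ?_, ?_⟩
  · rw [hu ω]
    exact ⟨sampleWeights_nonneg _, hammingNorm_sampleWeights_le _⟩
  have hε0 := hε.1
  have hk0 : sampleSize d ε δ ≠ 0 := sampleSize_ne_zero hε0 hδ
  have hkpos : (0 : ℝ) < sampleSize d ε δ := by positivity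
  set t := √(ε / (1 + ε)) with ht
  have ht0 : 0 ≤ t := Real.sqrt_nonneg _
  have htsq : t ^ 2 = ε / (1 + ε) := Real.sq_sqrt (by positivity)
  let Bad : (Fin (sampleSize d ε δ) → Fin n) → Prop := fun S =>
    sampleSize d ε δ * t ≤ ‖∑ j, centeredSample (p (S j))‖
  have hbad : μ.real {ω | Bad (fun j => I j ω)} ≤ δ := by
    rw [hI.real_setOf]
    refine (sum_prod_tail_le _ hP.samplingProb_nonneg hP.sum_samplingProb
      (fun i => centeredSample (p i)) (fun i => norm_centeredSample _)
      hP.sum_smul_centeredSample ht0 _).trans ?_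
    rw [htsq]
    exact two_mul_exp_neg_sampleSize_le hP.one_le_dim hε hδ.1
  have hcover : (Set.univ : Set Ω) ⊆
      {ω | IsWeakCoreset p w (u ω) ε} ∪ {ω | Bad (fun j => I j ω)} := by
    intro ω _
    refine or_iff_not_imp_right.2 fun hω => ?_
    have hlt : ‖∑ j, centeredSample (p (I j ω))‖ < sampleSize d ε δ * t := not_le.1 hω
    change IsWeakCoreset p w (u ω) ε
    refine isWeakCoreset_of_norm_lt hP hε0 ?_
    rw [hu ω, sum_sampleWeights_smul_appendOne_sub p hk0, ← htsq, norm_smul, norm_inv,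
      Real.norm_natCast]
    refine pow_lt_pow_left₀ ?_ (by positivity) two_ne_zero
    rwa [inv_mul_lt_iff₀ hkpos]
  have hone : 1 ≤ μ.real {ω | IsWeakCoreset p w (u ω) ε} +
      μ.real {ω | Bad (fun j => I j ω)} := by
    calc (1 : ℝ) = μ.real Set.univ := probReal_univ.symm
      _ ≤ _ := (measureReal_mono hcover).trans (measureReal_union_le _ _)
  change 1 - δ ≤ μ.real {ω | IsWeakCoreset p w (u ω) ε}
  linarith
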